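/- Let $p\geq 2$ be a prime number, let $\mathbb{C}_p$ be the completion of an algebraic closure of $\mathbb{Q}_p$ with its absolute value $|\cdot|_p$, and let $d\geq 2$ be an integer. For $c\in\mathbb{C}_p$ define $f_c(z):=z^d+c$, viewed as a self-map of $\mathbb{P}^1(\mathbb{C}_p)=\mathbb{C}_p\cup\{\infty\}$. Call $f_c$ postcritically finite (PCF) if every critical point $x\in\mathbb{P}^1(\mathbb{C}_p)$ of $f_c$ (that is, every point where $f_c$ has multiplicity at least $2$) is preperiodic, i.e. $f_c^n(x)=f_c^m(x)$ for some integers $n>m\geq 0$, where $f_c^n$ denotes the $n$-th iterate. If $c\in\mathbb{C}_p$ is a parameter for which $f_c$ is PCF, then $|c|_p\leq 1$. Moreover, for any $a\in\mathbb{C}_p$ with $|a|_p\leq 1$ and any radius $0<s<1$, there are only finitely many $c$ in the closed disk $\bar{D}(a,s)=\{x\in\mathbb{C}_p : |x-a|_p\leq s\}$ such that $f_c$ is PCF. -/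

import Mathlib

open scoped OnePoint

noncomputable section

namespace RatDyn

variable {K : Type*} [Field K]

/-- The degree of a rational function: the maximum of the degrees of its numerator and
denominator in lowest terms. -/
def degree (f : RatFunc K) : ℕ :=
  max f.num.natDegree f.denom.natDegree

/-- The point `[a : b]` of the projective line `ℙ¹(K) = K ∪ {∞}`, for `(a, b) ≠ (0, 0)`. -/
def ratio (a b : K) : OnePoint K :=
  open Classical in if b = 0 then ∞ else ((a / b : K) : OnePoint K)

/-- The self-map of `ℙ¹(K) = K ∪ {∞}` induced by a rational function `f = g / h` in lowest terms.
The value at `∞` is read off from the coefficients of `g` and `h` in degree `deg f`. -/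
def toMap (f : RatFunc K) : OnePoint K → OnePoint K
  | ∞ => ratio (f.num.coeff (degree f)) (f.denom.coeff (degree f))
  | (x : K) => ratio (f.num.eval x) (f.denom.eval x)

/-- For `f = g / h` in lowest terms, a polynomial whose zeros are the finite solutions of
`f(x) = y`, counted with multiplicity: `g - y h` for finite `y`, and `h` for `y = ∞`. -/
def fiberPoly (f : RatFunc K) : OnePoint K → Polynomial K
  | ∞ => f.denom
  | (y : K) => f.num - Polynomial.C y * f.denom

/-- The multiplicity (ramification index) with which a nonconstant `f` takes the value `f(x)` at the
point `x ∈ ℙ¹(K)`. At `x = ∞` it is the order of vanishing at `∞` of the degree `deg f`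
homogenization of the fiber polynomial. -/
def multiplicity (f : RatFunc K) : OnePoint K → ℕ
  | ∞ => degree f - (fiberPoly f (toMap f ∞)).natDegree
  | (x : K) => (fiberPoly f (toMap f (x : OnePoint K))).rootMultiplicity x

/-- A critical point of `f` is a point of `ℙ¹(K)` where `f` has multiplicity at least `2`. -/
def IsCriticalPoint (f : RatFunc K) (x : OnePoint K) : Prop :=
  2 ≤ multiplicity f x

/-- `x` is preperiodic under `F` if `Fⁿ(x) = Fᵐ(x)` for some `n > m ≥ 0`. -/
def IsPreperiodic {X : Type*} (F : X → X) (x : X) : Prop :=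
  ∃ m n : ℕ, m < n ∧ F^[n] x = F^[m] x

/-- A rational function over an algebraically closed field is postcritically finite (PCF) if
each of its critical points in `ℙ¹(K)` is preperiodic. -/
def IsPCF [IsAlgClosed K] (f : RatFunc K) : Prop :=
  ∀ x : OnePoint K, IsCriticalPoint f x → IsPreperiodic (toMap f) x

/-- The unicritical polynomial `f_c(z) = z ^ d + c`, as a rational function. -/
def unicritical (d : ℕ) (c : K) : RatFunc K :=
  RatFunc.X ^ d + RatFunc.C c

end RatDyn

end

/-! A postcritically finite `f_c` has a preperiodic critical orbit `z_n(c) = f_c^n(0)`. If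
`1 < |c|` that orbit escapes, and otherwise it suffices to bound the preperiod and the period
uniformly on each disk of radius `s < 1`: the equations `z_{T+N}(c) = z_T(c)` are nontrivial
polynomial equations in `c`.

Algebraic elements are dense, so the disk may be centered at an integral `b`. There the orbit and
its multipliers live in the finite-dimensional, hence locally compact, field `ℚ_p(b)` and recur by
compactness; since `c ↦ z_n(c)` is `1`-Lipschitz, the recurrence persists on the whole disk.

If the derivative of `f_b` is small somewhere along the orbit, an iterate of `f_c` contracts near
the orbit, which must then fall into its cycle after boundedly many steps because distinct `d`-th
roots of the same number cannot be too close. Otherwise an iterate of `f_c` has derivative close to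
`1` on a small disk around an orbit point; its `p^J`-th iterate is so close to the identity that a
preperiodic point of it is fixed. -/

namespace RatDyn

open Polynomial

section Ultrametric

section AddGroup

variable {E : Type*} [SeminormedAddCommGroup E] [IsUltrametricDist E] {x y z : E} {C : ℝ}

theorem norm_add_le_of_norm_le (hx : ‖x‖ ≤ C) (hy : ‖y‖ ≤ C) : ‖x + y‖ ≤ C :=
  (IsUltrametricDist.norm_add_le_max x y).trans (max_le hx hy)

theorem norm_sub_le_of_norm_le (hx : ‖x‖ ≤ C) (hy : ‖y‖ ≤ C) : ‖x - y‖ ≤ C := by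
  rw [sub_eq_add_neg]
  exact norm_add_le_of_norm_le hx (by rwa [norm_neg])

theorem norm_sub_le_trans (hxy : ‖x - y‖ ≤ C) (hyz : ‖y - z‖ ≤ C) : ‖x - z‖ ≤ C := by
  simpa using norm_add_le_of_norm_le hxy hyz

theorem norm_le_of_norm_sub_le (hxy : ‖x - y‖ ≤ C) (hy : ‖y‖ ≤ C) : ‖x‖ ≤ C := by
  simpa using norm_add_le_of_norm_le hxy hy

theorem norm_eq_of_norm_sub_lt (h : ‖x - y‖ < ‖y‖) : ‖x‖ = ‖y‖ := by
  have := IsUltrametricDist.norm_add_eq_max_of_norm_ne_norm h.ne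
  rwa [sub_add_cancel, max_eq_right h.le] at this

end AddGroup

variable {K : Type*} [NormedField K] [IsUltrametricDist K] {x y : K}

theorem norm_mul_sub_mul_le {u v : K} {C : ℝ} (hu : ‖u‖ ≤ 1) (hy : ‖y‖ ≤ 1)
    (huv : ‖u - v‖ ≤ C) (hxy : ‖x - y‖ ≤ C) : ‖u * x - v * y‖ ≤ C := by
  have h : u * x - v * y = u * (x - y) + (u - v) * y := by ring
  rw [h]
  refine norm_add_le_of_norm_le ?_ ?_ <;> rw [norm_mul]
  · exact (mul_le_of_le_one_left (norm_nonneg _) hu).trans hxy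
  · exact (mul_le_of_le_one_right (norm_nonneg _) hy).trans huv

theorem norm_pow_sub_pow_le (hx : ‖x‖ ≤ 1) (hy : ‖y‖ ≤ 1) (n : ℕ) :
    ‖x ^ n - y ^ n‖ ≤ ‖x - y‖ := by
  induction n with
  | zero => simp
  | succ n ih =>
    rw [pow_succ, pow_succ]
    exact norm_mul_sub_mul_le (by simpa using pow_le_one₀ (norm_nonneg x) hx) hy ih le_rfl

theorem norm_prod_range_sub_prod_range_le {u v : ℕ → K} {C : ℝ} (hC : 0 ≤ C)
    (hu : ∀ i, ‖u i‖ ≤ 1) (hv : ∀ i, ‖v i‖ ≤ 1) (huv : ∀ i, ‖u i - v i‖ ≤ C) (n : ℕ) :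
    ‖∏ i ∈ Finset.range n, u i - ∏ i ∈ Finset.range n, v i‖ ≤ C := by
  induction n with
  | zero => simpa using hC
  | succ n ih =>
    rw [Finset.prod_range_succ, Finset.prod_range_succ]
    refine norm_mul_sub_mul_le ?_ (hv n) ih (huv n)
    rw [norm_prod]
    exact Finset.prod_le_one (fun _ _ => norm_nonneg _) fun i _ => hu i

theorem norm_pow_sub_pow_sub_le (hx : ‖x‖ ≤ 1) (hy : ‖y‖ ≤ 1) (n : ℕ) :
    ‖x ^ n - y ^ n - n * y ^ (n - 1) * (x - y)‖ ≤ ‖x - y‖ ^ 2 := by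
  have hpow (k : ℕ) : ‖y ^ k‖ ≤ 1 := by simpa using pow_le_one₀ (norm_nonneg y) hy
  induction n with
  | zero => simp
  | succ n ih =>
    have hstep : x ^ (n + 1) - y ^ (n + 1) - (n + 1 : ℕ) * y ^ (n + 1 - 1) * (x - y) =
        x * (x ^ n - y ^ n - n * y ^ (n - 1) * (x - y)) + n * y ^ (n - 1) * (x - y) ^ 2 := by
      rcases n with _ | n
      · simp
      · push_cast [Nat.add_sub_cancel]
        ring
    rw [hstep]
    refine norm_add_le_of_norm_le ?_ ?_
    · rw [norm_mul]
      exact (mul_le_of_le_one_left (norm_nonneg _) hx).trans ih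
    · rw [norm_mul, norm_mul, norm_pow (x - y)]
      exact mul_le_of_le_one_left (by positivity)
        (mul_le_one₀ (IsUltrametricDist.norm_natCast_le_one K n) (norm_nonneg _) (hpow _))

theorem norm_pow_sub_pow_le_mul {ρ : ℝ} (hx : ‖x‖ ≤ 1) (hy : ‖y‖ ≤ 1) {n : ℕ}
    (hn : ‖(n : K) * y ^ (n - 1)‖ ≤ ρ) (hxy : ‖x - y‖ ≤ ρ) :
    ‖x ^ n - y ^ n‖ ≤ ρ * ‖x - y‖ := by
  refine norm_le_of_norm_sub_le ((norm_pow_sub_pow_sub_le hx hy n).trans ?_) ?_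
  · rw [sq]
    gcongr
  · rw [norm_mul]
    gcongr

theorem norm_natCast_mul_norm_le_of_pow_eq {n : ℕ} (hn : n ≠ 0) (h : x ^ n = y ^ n)
    (hne : x ≠ y) : ‖(n : K)‖ * ‖y‖ ≤ ‖x - y‖ := by
  rcases eq_or_ne y 0 with rfl | hy
  · simp
  set ζ := x / y with hζ
  have hζn : ζ ^ n = 1 := by rw [hζ, div_pow, h, div_self (pow_ne_zero n hy)]
  have hζ1 : ‖ζ‖ = 1 := by
    rw [← pow_eq_one_iff_of_nonneg (norm_nonneg ζ) hn, ← norm_pow, hζn, norm_one]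
  have hpos : 0 < ‖ζ - 1‖ := by
    rw [norm_pos_iff, sub_ne_zero, hζ, ne_eq, div_eq_one_iff_eq hy]
    exact hne
  have hle := norm_pow_sub_pow_sub_le hζ1.le (norm_one (α := K)).le n
  simp only [hζn, one_pow, sub_self, zero_sub, norm_neg, mul_one, norm_mul, sq] at hle
  have hxy : x - y = (ζ - 1) * y := by rw [hζ, sub_mul, div_mul_cancel₀ x hy, one_mul]
  rw [hxy, norm_mul]
  gcongr
  exact le_of_mul_le_mul_right hle hpos

end Ultrametric

section NearIdentity

variable {K : Type*} [NormedField K]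

/-- A self-map `g` of `U` whose displacement `g - id` is `ε`-Lipschitz. -/
structure IsNearId (U : Set K) (ε : ℝ) (g : K → K) : Prop where
  mapsTo : Set.MapsTo g U U
  norm_displacement_sub_le :
    ∀ z ∈ U, ∀ w ∈ U, ‖(g z - z) - (g w - w)‖ ≤ ε * ‖z - w‖

namespace IsNearId

variable {U : Set K} {ε : ℝ} {g : K → K} {x z w : K}

theorem injOn (hg : IsNearId U ε g) (hε : ε < 1) : Set.InjOn g U := by
  intro z hz w hw h
  have hle := hg.norm_displacement_sub_le z hz w hw
  rw [h, sub_sub_sub_cancel_left, norm_sub_rev] at hle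
  by_contra hne
  have hpos : 0 < ‖z - w‖ := norm_pos_iff.2 (sub_ne_zero.2 hne)
  exact absurd (le_of_mul_le_mul_right ((one_mul _).trans_le hle) hpos) hε.not_ge

variable [IsUltrametricDist K]

theorem norm_sub_le (hg : IsNearId U ε g) (hε : ε ≤ 1) (hz : z ∈ U) (hw : w ∈ U) :
    ‖g z - g w‖ ≤ ‖z - w‖ := by
  refine norm_le_of_norm_sub_le (y := z - w) ?_ le_rfl
  rw [sub_sub_sub_comm]
  exact (hg.norm_displacement_sub_le z hz w hw).trans (mul_le_of_le_one_left (norm_nonneg _) hε)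

theorem iterate (hg : IsNearId U ε g) (hε₀ : 0 ≤ ε) (hε : ε ≤ 1) (n : ℕ) :
    IsNearId U ε g^[n] := by
  induction n with
  | zero =>
    refine ⟨Set.mapsTo_id U, fun z _ w _ => ?_⟩
    simp only [Function.iterate_zero, id, sub_self, norm_zero]
    positivity
  | succ n ih =>
    refine ⟨hg.mapsTo.iterate (n + 1), fun z hz w hw => ?_⟩
    rw [Function.iterate_succ_apply', Function.iterate_succ_apply']
    have hlast := (hg.norm_displacement_sub_le _ (ih.mapsTo hz) _ (ih.mapsTo hw)).trans
      (mul_le_mul_of_nonneg_left (ih.norm_sub_le hε hz hw) hε₀)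
    have hsplit : g (g^[n] z) - z - (g (g^[n] w) - w) =
        (g (g^[n] z) - g^[n] z - (g (g^[n] w) - g^[n] w)) + (g^[n] z - z - (g^[n] w - w)) := by
      ring
    rw [hsplit]
    exact norm_add_le_of_norm_le hlast (ih.norm_displacement_sub_le z hz w hw)

theorem norm_iterate_sub_self_sub_le (hg : IsNearId U ε g) (hε₀ : 0 ≤ ε) (hε : ε ≤ 1)
    (hz : z ∈ U) (n : ℕ) : ‖g^[n] z - z - n * (g z - z)‖ ≤ ε * ‖g z - z‖ := by
  induction n with
  | zero =>
    simp only [Function.iterate_zero, id, sub_self, Nat.cast_zero, zero_mul, norm_zero]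
    positivity
  | succ n ih =>
    have hstep :=
      (hg.iterate hε₀ hε n).norm_displacement_sub_le _ (hg.mapsTo hz) z hz
    rw [← Function.iterate_succ_apply] at hstep
    have hsplit : g^[n + 1] z - z - (n + 1 : ℕ) * (g z - z) =
        (g^[n + 1] z - g z - (g^[n] z - z)) + (g^[n] z - z - n * (g z - z)) := by
      push_cast
      ring
    rw [hsplit]
    exact norm_add_le_of_norm_le hstep ih

theorem norm_iterate_sub_self (hg : IsNearId U ε g) (hε₀ : 0 ≤ ε)
    (hprime : ∀ q : ℕ, q.Prime → ε < ‖(q : K)‖) (hz : z ∈ U) {n : ℕ} (hn : n ≠ 0) :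
    ‖g^[n] z - z‖ = ‖(n : K)‖ * ‖g z - z‖ := by
  have hε : ε ≤ 1 :=
    (hprime 2 Nat.prime_two).le.trans (IsUltrametricDist.norm_natCast_le_one K 2)
  induction n using Nat.recOnMul generalizing g with
  | zero => exact absurd rfl hn
  | one => simp
  | prime q hq =>
    rcases eq_or_ne (g z) z with hfix | hmoved
    · rw [Function.iterate_fixed hfix, hfix, sub_self, norm_zero, mul_zero]
    · rw [← norm_mul]
      refine norm_eq_of_norm_sub_lt ?_
      rw [norm_mul]
      refine (hg.norm_iterate_sub_self_sub_le hε₀ hε hz q).trans_lt ?_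
      exact mul_lt_mul_of_pos_right (hprime q hq) (norm_pos_iff.2 (sub_ne_zero.2 hmoved))
  | mul a b iha ihb =>
    rw [Function.iterate_mul, ihb (hg.iterate hε₀ hε a) (right_ne_zero_of_mul hn),
      iha hg (left_ne_zero_of_mul hn), Nat.cast_mul, norm_mul]
    ring

theorem apply_eq_of_isPreperiodic [CharZero K] (hg : IsNearId U ε g) (hε₀ : 0 ≤ ε)
    (hprime : ∀ q : ℕ, q.Prime → ε < ‖(q : K)‖) (hx : x ∈ U) (h : IsPreperiodic g x) :
    g x = x := by
  have hε : ε < 1 :=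
    (hprime 2 Nat.prime_two).trans_le (IsUltrametricDist.norm_natCast_le_one K 2)
  obtain ⟨m, n, hmn, hper⟩ := h
  obtain ⟨l, rfl⟩ := Nat.exists_eq_add_of_le hmn.le
  have hl : l ≠ 0 := by omega
  rw [Function.iterate_add_apply] at hper
  have hperiodic : g^[l] x = x :=
    (hg.injOn hε).iterate hg.mapsTo m (hg.mapsTo.iterate l hx) hx hper
  have hzero := hg.norm_iterate_sub_self hε₀ hprime hx hl
  rw [hperiodic, sub_self, norm_zero, zero_eq_mul, norm_eq_zero, norm_eq_zero, sub_eq_zero]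
    at hzero
  exact hzero.resolve_left (Nat.cast_ne_zero.2 hl)

end IsNearId

end NearIdentity

section GaussNorm

variable {K : Type*} [NormedField K]

/-- The Gauss norm of `P` on the disk of radius `r` about `0`, that is `max ‖aᵢ‖ rⁱ`. -/
abbrev diskNorm (r : ℝ) (P : K[X]) : ℝ :=
  P.gaussNorm (NormedField.toAbsoluteValue K) r

variable {r s B : ℝ} {P Q R : K[X]}

theorem diskNorm_le_iff (hr : 0 ≤ r) : diskNorm r P ≤ B ↔ ∀ i, ‖P.coeff i‖ * r ^ i ≤ B := by
  refine ⟨fun h i => (le_gaussNorm _ P hr i).trans h, fun h => ?_⟩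
  obtain ⟨i, hi⟩ := exists_eq_gaussNorm (NormedField.toAbsoluteValue K) r P
  exact hi.trans_le (h i)

theorem diskNorm_nonneg (hr : 0 ≤ r) (P : K[X]) : 0 ≤ diskNorm r P :=
  gaussNorm_nonneg _ P hr

theorem diskNorm_X (r : ℝ) : diskNorm r (X : K[X]) = r := by
  rw [diskNorm, ← monomial_one_one_eq_X, gaussNorm_monomial, map_one, one_mul, pow_one]

variable [IsUltrametricDist K]

theorem isNonarchimedean_toAbsoluteValue :
    IsNonarchimedean (NormedField.toAbsoluteValue K) :=
  IsUltrametricDist.isNonarchimedean_norm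

theorem diskNorm_add_le (hr : 0 ≤ r) (hP : diskNorm r P ≤ B) (hQ : diskNorm r Q ≤ B) :
    diskNorm r (P + Q) ≤ B :=
  (isNonarchimedean_gaussNorm _ isNonarchimedean_toAbsoluteValue hr P Q).trans (max_le hP hQ)

theorem diskNorm_le_of_sub_X_le (hr : 0 ≤ r) (hP : diskNorm r (P - X) ≤ r) :
    diskNorm r P ≤ r := by
  rw [← sub_add_cancel P X]
  exact diskNorm_add_le hr hP (diskNorm_X r).le

theorem norm_eval_le (hr : 0 ≤ r) {w : K} (hw : ‖w‖ ≤ r) (P : K[X]) :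
    ‖P.eval w‖ ≤ diskNorm r P := by
  rw [eval_eq_sum_range]
  refine IsUltrametricDist.norm_sum_le_of_forall_le_of_nonneg (diskNorm_nonneg hr P) fun i _ => ?_
  rw [norm_mul, norm_pow]
  refine le_trans ?_ ((diskNorm_le_iff hr).1 le_rfl i)
  gcongr

theorem diskNorm_mul (hr : 0 < r) (P Q : K[X]) :
    diskNorm r (P * Q) = diskNorm r P * diskNorm r Q :=
  gaussNorm_mul isNonarchimedean_toAbsoluteValue hr P Q

theorem diskNorm_sum_le {ι : Type*} (t : Finset ι) {F : ι → K[X]} (hr : 0 ≤ r) (hB : 0 ≤ B)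
    (hF : ∀ i ∈ t, diskNorm r (F i) ≤ B) : diskNorm r (∑ i ∈ t, F i) ≤ B :=
  Finset.sum_induction F (fun P => diskNorm r P ≤ B) (fun _ _ => diskNorm_add_le hr)
    (by simpa using hB) hF

theorem diskNorm_pow (hr : 0 < r) (P : K[X]) (n : ℕ) :
    diskNorm r (P ^ n) = diskNorm r P ^ n := by
  induction n with
  | zero => simpa using gaussNorm_C (NormedField.toAbsoluteValue K) r (1 : K)
  | succ n ih => rw [pow_succ, pow_succ, diskNorm_mul hr, ih]

theorem diskNorm_pow_sub_pow_le (hs : 0 < s) (hr : 0 < r) (hP : diskNorm s P ≤ r)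
    (hQ : diskNorm s Q ≤ r) (n : ℕ) :
    diskNorm s (P ^ n - Q ^ n) ≤ r ^ n / r * diskNorm s (P - Q) := by
  have hPQ := diskNorm_nonneg hs.le (P - Q)
  rcases n with _ | n
  · simp only [pow_zero, sub_self, gaussNorm_zero]
    positivity
  rw [← geom_sum₂_mul, diskNorm_mul hs, pow_succ, mul_div_cancel_right₀ _ hr.ne']
  gcongr
  refine diskNorm_sum_le _ hs.le (by positivity) fun i hi => ?_
  rw [diskNorm_mul hs, diskNorm_pow hs, diskNorm_pow hs]
  rw [Nat.add_sub_cancel, ← pow_mul_pow_sub r (Finset.mem_range_succ_iff.1 hi)]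
  have hP₀ := diskNorm_nonneg hs.le P
  have hQ₀ := diskNorm_nonneg hs.le Q
  gcongr

theorem diskNorm_comp_sub_comp_le (hs : 0 < s) (hr : 0 < r) (hP : diskNorm s P ≤ r)
    (hQ : diskNorm s Q ≤ r) (R : K[X]) :
    diskNorm s (R.comp P - R.comp Q) ≤ diskNorm r R / r * diskNorm s (P - Q) := by
  have hPQ := diskNorm_nonneg hs.le (P - Q)
  have hR := diskNorm_nonneg hr.le R
  rw [comp, comp, eval₂_eq_sum_range, eval₂_eq_sum_range, ← Finset.sum_sub_distrib]
  refine diskNorm_sum_le _ hs.le (by positivity) fun i _ => ?_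
  rw [← mul_sub, diskNorm_mul hs, diskNorm, gaussNorm_C]
  calc ‖R.coeff i‖ * diskNorm s (P ^ i - Q ^ i)
      ≤ ‖R.coeff i‖ * (r ^ i / r * diskNorm s (P - Q)) := by
        gcongr
        exact diskNorm_pow_sub_pow_le hs hr hP hQ i
    _ = ‖R.coeff i‖ * r ^ i / r * diskNorm s (P - Q) := by ring
    _ ≤ diskNorm r R / r * diskNorm s (P - Q) := by
        gcongr
        exact (diskNorm_le_iff hr.le).1 le_rfl i

theorem norm_eval_sub_eval_le (hr : 0 < r) {z w : K} (hz : ‖z‖ ≤ r) (hw : ‖w‖ ≤ r) (R : K[X]) :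
    ‖R.eval z - R.eval w‖ ≤ diskNorm r R / r * ‖z - w‖ := by
  have hC (x : K) : diskNorm 1 (C x) = ‖x‖ := gaussNorm_C _ _ _
  have := diskNorm_comp_sub_comp_le one_pos hr ((hC z).trans_le hz) ((hC w).trans_le hw) R
  rwa [comp_C, comp_C, ← C_sub, ← C_sub, hC, hC] at this

theorem diskNorm_pow_apply_sub_le {T : AddMonoid.End K[X]} {δ : ℝ} (hr : 0 ≤ r) (hδ : δ ≤ 1)
    (hδ₀ : 0 ≤ δ) (hT : ∀ P, diskNorm r (T P - P) ≤ δ * diskNorm r P) (n : ℕ) (P : K[X]) :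
    diskNorm r ((T ^ n) P - P) ≤ δ * diskNorm r P := by
  induction n generalizing P with
  | zero =>
    rw [pow_zero, AddMonoid.End.coe_one, id, sub_self, diskNorm, gaussNorm_zero]
    exact mul_nonneg hδ₀ (diskNorm_nonneg hr P)
  | succ n ih =>
    have hTP : diskNorm r (T P) ≤ diskNorm r P := by
      rw [← sub_add_cancel (T P) P]
      exact diskNorm_add_le hr
        ((hT P).trans (mul_le_of_le_one_left (diskNorm_nonneg hr P) hδ)) le_rfl
    rw [pow_succ, AddMonoid.End.coe_mul, Function.comp_apply, ← sub_add_sub_cancel _ (T P) P]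
    exact diskNorm_add_le hr ((ih (T P)).trans (mul_le_mul_of_nonneg_left hTP hδ₀)) (hT P)

theorem diskNorm_pow_apply_sub_sub_le {T : AddMonoid.End K[X]} {δ : ℝ} (hr : 0 ≤ r)
    (hδ : δ ≤ 1) (hδ₀ : 0 ≤ δ) (hT : ∀ P, diskNorm r (T P - P) ≤ δ * diskNorm r P) (n : ℕ)
    (P : K[X]) : diskNorm r ((T ^ n) P - P - C (n : K) * (T P - P)) ≤ δ * (δ * diskNorm r P) := by
  induction n with
  | zero =>
    have hzero : (T ^ 0) P - P - C ((0 : ℕ) : K) * (T P - P) = 0 := by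
      rw [pow_zero, AddMonoid.End.coe_one, id, sub_self, Nat.cast_zero, C_0, zero_mul, sub_zero]
    rw [hzero, diskNorm, gaussNorm_zero]
    exact mul_nonneg hδ₀ (mul_nonneg hδ₀ (diskNorm_nonneg hr P))
  | succ n ih =>
    have hsplit : (T ^ (n + 1)) P - P - C ((n + 1 : ℕ) : K) * (T P - P) =
        ((T ^ n) (T P - P) - (T P - P)) + ((T ^ n) P - P - C (n : K) * (T P - P)) := by
      rw [pow_succ, AddMonoid.End.coe_mul, Function.comp_apply, map_sub (T ^ n),
        Nat.cast_succ, C_add, C_1]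
      ring
    rw [hsplit]
    refine diskNorm_add_le hr ?_ ih
    exact (diskNorm_pow_apply_sub_le hr hδ hδ₀ hT n _).trans
      (mul_le_mul_of_nonneg_left (hT P) hδ₀)

theorem diskNorm_pow_pow_apply_sub_le {T : AddMonoid.End K[X]} {ρ : ℝ} {p : ℕ} (hr : 0 < r)
    (hρ : ρ ≤ 1) (hp : ‖(p : K)‖ ≤ ρ) (hT : ∀ P, diskNorm r (T P - P) ≤ ρ * diskNorm r P)
    (j : ℕ) (P : K[X]) : diskNorm r ((T ^ p ^ j) P - P) ≤ ρ ^ (j + 1) * diskNorm r P := by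
  have hρ₀ : 0 ≤ ρ := (norm_nonneg _).trans hp
  -- `S ^ p - 1 = p (S - 1) + O((S - 1) ^ 2)`, so each `p`-th power gains a factor `ρ`.
  induction j generalizing P with
  | zero => simpa using hT P
  | succ j ih =>
    set S := T ^ p ^ j
    have hP := diskNorm_nonneg hr.le P
    rw [pow_succ, pow_mul, ← sub_add_cancel ((S ^ p) P - P) (C (p : K) * (S P - P))]
    refine diskNorm_add_le hr.le ?_ ?_
    · refine (diskNorm_pow_apply_sub_sub_le hr.le (pow_le_one₀ hρ₀ hρ) (pow_nonneg hρ₀ _) ih p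
        P).trans ?_
      rw [pow_succ' ρ (j + 1), mul_assoc]
      gcongr
      exact pow_le_of_le_one hρ₀ hρ (Nat.succ_ne_zero j)
    · rw [diskNorm_mul hr, diskNorm, gaussNorm_C, pow_succ' ρ (j + 1), mul_assoc]
      exact mul_le_mul hp (ih P) (diskNorm_nonneg hr.le _) hρ₀

theorem isNearId_eval {G : K[X]} {ε : ℝ} (hr : 0 < r) (hε : ε ≤ 1)
    (hG : diskNorm r (G - X) ≤ ε * r) :
    IsNearId (Metric.closedBall 0 r) ε (fun w => G.eval w) := by
  refine ⟨fun w hw => ?_, fun z hz w hw => ?_⟩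
  · rw [mem_closedBall_zero_iff] at hw ⊢
    exact (norm_eval_le hr.le hw G).trans
      (diskNorm_le_of_sub_X_le hr.le (hG.trans (mul_le_of_le_one_left hr.le hε)))
  · rw [mem_closedBall_zero_iff] at hz hw
    have h := norm_eval_sub_eval_le hr hz hw (G - X)
    rw [eval_sub, eval_sub, eval_X, eval_X] at h
    refine h.trans ?_
    gcongr
    rwa [div_le_iff₀ hr]

theorem isNearId_eval_iterate_pow {Q : K[X]} {ρ : ℝ} {p : ℕ} (hr : 0 < r) (hρ : ρ ≤ 1)
    (hp : ‖(p : K)‖ ≤ ρ) (hQ : diskNorm r (Q - X) ≤ ρ * r) (j : ℕ) :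
    IsNearId (Metric.closedBall 0 r) (ρ ^ (j + 1)) (fun w => Q.eval w)^[p ^ j] := by
  have hρ₀ : 0 ≤ ρ := (norm_nonneg _).trans hp
  have hX := (diskNorm_X (K := K) r).le
  have hQr : diskNorm r Q ≤ r :=
    diskNorm_le_of_sub_X_le hr.le (hQ.trans (mul_le_of_le_one_left hr.le hρ))
  set T : AddMonoid.End K[X] := (compRingHom Q).toAddMonoidHom
  have hT (P : K[X]) : diskNorm r (T P - P) ≤ ρ * diskNorm r P := by
    have hcomp := diskNorm_comp_sub_comp_le hr hr hQr hX P
    rw [comp_X] at hcomp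
    calc diskNorm r (T P - P) ≤ diskNorm r P / r * diskNorm r (Q - X) := hcomp
      _ ≤ diskNorm r P / r * (ρ * r) := by
        have := diskNorm_nonneg hr.le P
        gcongr
      _ = ρ * diskNorm r P := by field_simp
  have heval (n : ℕ) (w : K) : ((T ^ n) X).eval w = (fun w => Q.eval w)^[n] w := by
    induction n generalizing w with
    | zero => simp
    | succ n ih =>
      rw [pow_succ', AddMonoid.End.coe_mul, Function.comp_apply, Function.iterate_succ_apply, ← ih]
      exact eval_comp
  have hTX := diskNorm_pow_pow_apply_sub_le hr hρ hp hT j X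
  rw [diskNorm_X] at hTX
  simpa only [heval] using isNearId_eval hr (pow_le_one₀ hρ₀ hρ) hTX

end GaussNorm

section Iterate

variable {α : Type*} {F : α → α} {x : α}

theorem iterate_add_eq_of_le {k m l : ℕ} (h : F^[m + l] x = F^[m] x) (hmk : m ≤ k) :
    F^[k + l] x = F^[k] x := by
  obtain ⟨i, rfl⟩ := Nat.exists_eq_add_of_le' hmk
  rw [add_assoc, Function.iterate_add_apply, h, ← Function.iterate_add_apply]

theorem iterate_add_mul_eq {k l : ℕ} (h : F^[k + l] x = F^[k] x) (j : ℕ) :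
    F^[k + j * l] x = F^[k] x := by
  induction j with
  | zero => simp
  | succ j ih =>
    rw [Nat.succ_mul, ← add_assoc, iterate_add_eq_of_le h (Nat.le_add_right k _), ih]

theorem IsPreperiodic.exists_iterate_add_eq (h : IsPreperiodic F x) :
    ∃ m l, l ≠ 0 ∧ ∀ k, m ≤ k → F^[k + l] x = F^[k] x := by
  obtain ⟨m, n, hmn, hper⟩ := h
  refine ⟨m, n - m, by omega, fun k hk => iterate_add_eq_of_le ?_ hk⟩
  rwa [Nat.add_sub_cancel' hmn.le]

theorem IsPreperiodic.iterate (h : IsPreperiodic F x) (k i : ℕ) :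
    IsPreperiodic F^[k] (F^[i] x) := by
  obtain ⟨m, l, hl, hper⟩ := h.exists_iterate_add_eq
  refine ⟨m, m + l, by omega, ?_⟩
  rcases Nat.eq_zero_or_pos k with rfl | hk
  · simp
  rw [← Function.iterate_mul, ← Function.iterate_mul, ← Function.iterate_add_apply,
    ← Function.iterate_add_apply, mul_add, add_right_comm]
  exact iterate_add_mul_eq (hper _ (le_add_right (Nat.le_mul_of_pos_left m hk))) k

theorem IsPreperiodic.map {β : Type*} {G : β → β} {φ : α → β} (h : IsPreperiodic F x)
    (hφ : Function.Semiconj φ F G) : IsPreperiodic G (φ x) := by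
  obtain ⟨m, n, hmn, hper⟩ := h
  exact ⟨m, n, hmn, by rw [← hφ.iterate_right, ← hφ.iterate_right, hper]⟩

end Iterate

section CritOrbit

variable {R S : Type*} [CommRing R] [CommRing S]

/-- The map `z ↦ z ^ d + c` on a commutative ring. -/
def unicriticalMap (d : ℕ) (c z : R) : R :=
  z ^ d + c

/-- The orbit of the critical point `0` under `z ↦ z ^ d + c`. -/
def critOrbit (d : ℕ) (c : R) (n : ℕ) : R :=
  (unicriticalMap d c)^[n] 0

/-- The derivative at `critOrbit d c m` of the `n`-th iterate of `z ↦ z ^ d + c`. -/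
def critMultiplier (d : ℕ) (c : R) (m n : ℕ) : R :=
  ∏ i ∈ Finset.range n, d * critOrbit d c (m + i) ^ (d - 1)

theorem critOrbit_zero (d : ℕ) (c : R) : critOrbit d c 0 = 0 :=
  rfl

theorem critOrbit_succ (d : ℕ) (c : R) (n : ℕ) :
    critOrbit d c (n + 1) = critOrbit d c n ^ d + c :=
  Function.iterate_succ_apply' _ _ _

theorem iterate_critOrbit (d : ℕ) (c : R) (m n : ℕ) :
    (unicriticalMap d c)^[n] (critOrbit d c m) = critOrbit d c (m + n) := by
  rw [critOrbit, critOrbit, ← Function.iterate_add_apply, add_comm]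

theorem map_iterate_unicriticalMap (φ : R →+* S) (d : ℕ) (c z : R) (n : ℕ) :
    φ ((unicriticalMap d c)^[n] z) = (unicriticalMap d (φ c))^[n] (φ z) := by
  have hsemi : Function.Semiconj φ (unicriticalMap d c) (unicriticalMap d (φ c)) := fun z => by
    simp only [unicriticalMap, map_add, map_pow]
  exact hsemi.iterate_right n z

theorem map_critOrbit (φ : R →+* S) (d : ℕ) (c : R) (n : ℕ) :
    φ (critOrbit d c n) = critOrbit d (φ c) n := by
  rw [critOrbit, map_iterate_unicriticalMap, map_zero, critOrbit]

theorem map_critMultiplier (φ : R →+* S) (d : ℕ) (c : R) (m n : ℕ) :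
    φ (critMultiplier d c m n) = critMultiplier d (φ c) m n := by
  simp only [critMultiplier, map_prod, map_mul, map_pow, map_natCast, map_critOrbit]

theorem critMultiplier_add (d : ℕ) (c : R) (m k n : ℕ) :
    critMultiplier d c m (k + n) = critMultiplier d c m k * critMultiplier d c (m + k) n := by
  simp only [critMultiplier, Finset.prod_range_add, add_assoc]

variable [IsDomain R]

theorem natDegree_critOrbit_X {d : ℕ} (hd : 2 ≤ d) (n : ℕ) :
    (critOrbit d (X : R[X]) (n + 1)).natDegree = d ^ n := by
  induction n with
  | zero => simp [critOrbit_succ, critOrbit_zero, zero_pow (by omega : d ≠ 0)]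
  | succ n ih =>
    rw [critOrbit_succ, natDegree_add_eq_left_of_natDegree_lt, natDegree_pow, ih, pow_succ']
    rw [natDegree_X, natDegree_pow, ih, ← pow_succ']
    exact Nat.one_lt_pow (Nat.succ_ne_zero n) hd

theorem finite_setOf_critOrbit_eq {d : ℕ} (hd : 2 ≤ d) {m n : ℕ} (hmn : m < n) :
    {c : R | critOrbit d c n = critOrbit d c m}.Finite := by
  set P : R[X] := critOrbit d X n - critOrbit d X m
  have hP : P ≠ 0 := by
    rw [sub_ne_zero]
    intro h
    obtain ⟨n, rfl⟩ := Nat.exists_eq_add_of_lt hmn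
    have hdeg := congrArg natDegree h
    rw [natDegree_critOrbit_X hd] at hdeg
    rcases m with _ | m
    · rw [critOrbit_zero, natDegree_zero] at hdeg
      exact (pow_pos (by omega) _).ne' hdeg
    · rw [natDegree_critOrbit_X hd] at hdeg
      have := Nat.pow_right_injective hd hdeg
      omega
  refine (finite_setOfPred_isRoot hP).subset fun c hc => ?_
  rw [Set.mem_ofPred_eq] at hc
  have heval (k : ℕ) : (critOrbit d X k).eval c = critOrbit d c k := by
    simpa using map_critOrbit (evalRingHom c) d X k
  rw [Set.mem_ofPred_eq, IsRoot, eval_sub, heval, heval, hc, sub_self]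

end CritOrbit

section Unicritical

variable {K : Type*} [Field K]

theorem unicritical_eq_algebraMap (d : ℕ) (c : K) :
    unicritical d c = algebraMap K[X] (RatFunc K) (X ^ d + C c) := by
  simp [unicritical]

theorem num_unicritical (d : ℕ) (c : K) : (unicritical d c).num = X ^ d + C c := by
  rw [unicritical_eq_algebraMap, RatFunc.num_algebraMap]

theorem denom_unicritical (d : ℕ) (c : K) : (unicritical d c).denom = 1 := by
  rw [unicritical_eq_algebraMap, RatFunc.denom_algebraMap]

theorem toMap_unicritical_coe (d : ℕ) (c z : K) :
    toMap (unicritical d c) (z : OnePoint K) = (unicriticalMap d c z : K) := by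
  change ratio _ _ = _
  simp [ratio, num_unicritical, denom_unicritical, unicriticalMap]

theorem isCriticalPoint_unicritical_zero {d : ℕ} (hd : 2 ≤ d) (c : K) :
    IsCriticalPoint (unicritical d c) (0 : K) := by
  change 2 ≤ (fiberPoly _ (toMap _ _)).rootMultiplicity 0
  rw [toMap_unicritical_coe, unicriticalMap]
  change 2 ≤ ((unicritical d c).num - C _ * (unicritical d c).denom).rootMultiplicity 0
  rw [num_unicritical, denom_unicritical, zero_pow (by omega), zero_add, mul_one,
    add_sub_cancel_right, rootMultiplicity_eq_natTrailingDegree']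
  simpa using hd

theorem IsPCF.isPreperiodic_zero [IsAlgClosed K] {d : ℕ} (hd : 2 ≤ d) {c : K}
    (h : IsPCF (unicritical d c)) : IsPreperiodic (unicriticalMap d c) 0 := by
  obtain ⟨m, n, hmn, hper⟩ := h _ (isCriticalPoint_unicritical_zero hd c)
  have hsemi : Function.Semiconj ((↑) : K → OnePoint K) (unicriticalMap d c)
      (toMap (unicritical d c)) := fun z => (toMap_unicritical_coe d c z).symm
  rw [← hsemi.iterate_right, ← hsemi.iterate_right, OnePoint.coe_eq_coe] at hper
  exact ⟨m, n, hmn, hper⟩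

end Unicritical

section CritOrbitNorm

variable {K : Type*} [NormedField K] [IsUltrametricDist K] {d : ℕ} {b c z w : K}

theorem norm_critOrbit_succ (hd : 2 ≤ d) (hc : 1 < ‖c‖) (n : ℕ) :
    ‖critOrbit d c (n + 1)‖ = ‖c‖ ^ d ^ n := by
  induction n with
  | zero => rw [critOrbit_succ, critOrbit_zero, zero_pow (by omega), zero_add, pow_zero, pow_one]
  | succ n ih =>
    have hpow : ‖critOrbit d c (n + 1) ^ d‖ = ‖c‖ ^ d ^ (n + 1) := by
      rw [norm_pow, ih, ← pow_mul, pow_succ]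
    have hlt : ‖c‖ < ‖c‖ ^ d ^ (n + 1) := lt_self_pow₀ hc (Nat.one_lt_pow (by omega) hd)
    rw [critOrbit_succ, IsUltrametricDist.norm_add_eq_max_of_norm_ne_norm (hpow.trans_ne hlt.ne'),
      hpow, max_eq_left hlt.le]

theorem norm_le_one_of_isPreperiodic (hd : 2 ≤ d) (h : IsPreperiodic (unicriticalMap d c) 0) :
    ‖c‖ ≤ 1 := by
  obtain ⟨m, l, hl, hper⟩ := h.exists_iterate_add_eq
  by_contra! hc
  have hnorm : ‖critOrbit d c (m + l + 1)‖ = ‖critOrbit d c (m + 1)‖ := by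
    rw [add_right_comm]
    exact congrArg norm (hper (m + 1) (Nat.le_succ m))
  rw [norm_critOrbit_succ hd hc, norm_critOrbit_succ hd hc] at hnorm
  have := Nat.pow_right_injective hd (pow_right_injective₀ (by positivity) hc.ne' hnorm)
  omega

theorem norm_critOrbit_le_one (hc : ‖c‖ ≤ 1) (n : ℕ) : ‖critOrbit d c n‖ ≤ 1 := by
  induction n with
  | zero => simp [critOrbit_zero]
  | succ n ih =>
    rw [critOrbit_succ]
    exact norm_add_le_of_norm_le
      ((norm_pow _ d).trans_le (pow_le_one₀ (norm_nonneg _) ih)) hc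

theorem norm_critOrbit_add_sub_le (hc : ‖c‖ ≤ 1) (m n k : ℕ) :
    ‖critOrbit d c (m + k) - critOrbit d c (n + k)‖ ≤ ‖critOrbit d c m - critOrbit d c n‖ := by
  induction k with
  | zero => rfl
  | succ k ih =>
    rw [← add_assoc, ← add_assoc, critOrbit_succ, critOrbit_succ, add_sub_add_right_eq_sub]
    exact (norm_pow_sub_pow_le (norm_critOrbit_le_one hc _) (norm_critOrbit_le_one hc _) d).trans ih

theorem norm_critOrbit_sub_critOrbit_le (hc : ‖c‖ ≤ 1) (hb : ‖b‖ ≤ 1) (n : ℕ) :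
    ‖critOrbit d c n - critOrbit d b n‖ ≤ ‖c - b‖ := by
  induction n with
  | zero => simp [critOrbit_zero]
  | succ n ih =>
    rw [critOrbit_succ, critOrbit_succ, add_sub_add_comm]
    refine norm_add_le_of_norm_le (le_trans ?_ ih) le_rfl
    exact norm_pow_sub_pow_le (norm_critOrbit_le_one hc n) (norm_critOrbit_le_one hb n) d

theorem norm_natCast_mul_pow_le_one (hz : ‖z‖ ≤ 1) (m n : ℕ) : ‖(m : K) * z ^ n‖ ≤ 1 := by
  rw [norm_mul, norm_pow]
  exact mul_le_one₀ (IsUltrametricDist.norm_natCast_le_one K m) (by positivity)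
    (pow_le_one₀ (norm_nonneg z) hz)

theorem norm_natCast_mul_pow_sub_le (hz : ‖z‖ ≤ 1) (hw : ‖w‖ ≤ 1) (m n : ℕ) :
    ‖(m : K) * z ^ n - m * w ^ n‖ ≤ ‖z - w‖ := by
  rw [← mul_sub, norm_mul]
  exact (mul_le_of_le_one_left (norm_nonneg _)
    (IsUltrametricDist.norm_natCast_le_one K m)).trans (norm_pow_sub_pow_le hz hw n)

theorem norm_critMultiplier_le_one (hc : ‖c‖ ≤ 1) (m n : ℕ) : ‖critMultiplier d c m n‖ ≤ 1 := by
  rw [critMultiplier, norm_prod]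
  exact Finset.prod_le_one (fun _ _ => norm_nonneg _) fun i _ =>
    norm_natCast_mul_pow_le_one (norm_critOrbit_le_one hc _) d (d - 1)

theorem norm_critMultiplier_sub_critMultiplier_le (hc : ‖c‖ ≤ 1) (hb : ‖b‖ ≤ 1) (m n : ℕ) :
    ‖critMultiplier d c m n - critMultiplier d b m n‖ ≤ ‖c - b‖ :=
  norm_prod_range_sub_prod_range_le (norm_nonneg _)
    (fun _ => norm_natCast_mul_pow_le_one (norm_critOrbit_le_one hc _) d (d - 1))
    (fun _ => norm_natCast_mul_pow_le_one (norm_critOrbit_le_one hb _) d (d - 1))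
    (fun _ => (norm_natCast_mul_pow_sub_le (norm_critOrbit_le_one hc _)
      (norm_critOrbit_le_one hb _) d (d - 1)).trans (norm_critOrbit_sub_critOrbit_le hc hb _)) n

end CritOrbitNorm

section Attracting

variable {K : Type*} [NormedField K] [IsUltrametricDist K] {d : ℕ} {c : K} {M N : ℕ} {ρ : ℝ}

theorem norm_critOrbit_add_sub_le_mul (hc : ‖c‖ ≤ 1) (hN : N ≠ 0)
    (hder : ‖(d : K) * critOrbit d c M ^ (d - 1)‖ ≤ ρ)
    (hret : ‖critOrbit d c (M + N) - critOrbit d c M‖ ≤ ρ) :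
    ‖critOrbit d c (M + N + N) - critOrbit d c (M + N)‖ ≤
      ρ * ‖critOrbit d c (M + N) - critOrbit d c M‖ := by
  have hstep := norm_pow_sub_pow_le_mul (norm_critOrbit_le_one (d := d) hc _)
    (norm_critOrbit_le_one hc _) hder hret
  rw [← add_sub_add_right_eq_sub _ _ c, ← critOrbit_succ, ← critOrbit_succ] at hstep
  obtain ⟨k, rfl⟩ := Nat.exists_eq_add_of_le (Nat.one_le_iff_ne_zero.2 hN)
  have hrest := norm_critOrbit_add_sub_le (d := d) hc (M + (1 + k) + 1) (M + 1) k
  simp only [add_assoc] at hrest hstep ⊢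
  exact hrest.trans hstep

theorem norm_natCast_mul_critOrbit_add_mul_pow_le (hc : ‖c‖ ≤ 1)
    (hder : ‖(d : K) * critOrbit d c M ^ (d - 1)‖ ≤ ρ)
    (hret : ‖critOrbit d c (M + N) - critOrbit d c M‖ ≤ ρ) (k : ℕ) :
    ‖(d : K) * critOrbit d c (M + k * N) ^ (d - 1)‖ ≤ ρ := by
  induction k generalizing M with
  | zero => simpa using hder
  | succ k ih =>
    rw [Nat.succ_mul, add_comm (k * N), ← add_assoc M]
    refine ih (norm_le_of_norm_sub_le (le_trans ?_ hret) hder)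
      ((norm_critOrbit_add_sub_le hc (M + N) M N).trans hret)
    exact norm_natCast_mul_pow_sub_le (norm_critOrbit_le_one hc _) (norm_critOrbit_le_one hc _)
      d (d - 1)

theorem norm_critOrbit_add_mul_sub_le_pow_mul (hc : ‖c‖ ≤ 1) (hN : N ≠ 0)
    (hder : ‖(d : K) * critOrbit d c M ^ (d - 1)‖ ≤ ρ)
    (hret : ‖critOrbit d c (M + N) - critOrbit d c M‖ ≤ ρ) (k : ℕ) :
    ‖critOrbit d c (M + k * N + N) - critOrbit d c (M + k * N)‖ ≤
      ρ ^ k * ‖critOrbit d c (M + N) - critOrbit d c M‖ := by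
  induction k with
  | zero => simp
  | succ k ih =>
    have hρ : 0 ≤ ρ := (norm_nonneg _).trans hret
    have hret' : ‖critOrbit d c (M + k * N + N) - critOrbit d c (M + k * N)‖ ≤ ρ := by
      rw [add_right_comm]
      exact (norm_critOrbit_add_sub_le hc (M + N) M (k * N)).trans hret
    rw [Nat.succ_mul, ← add_assoc M, pow_succ', mul_assoc]
    exact (norm_critOrbit_add_sub_le_mul hc hN
      (norm_natCast_mul_critOrbit_add_mul_pow_le hc hder hret k) hret').trans
      (mul_le_mul_of_nonneg_left ih hρ)

theorem exists_critOrbit_add_eq_of_attracting (hc : ‖c‖ ≤ 1) (hN : N ≠ 0) (hρ : ρ < 1)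
    (hder : ‖(d : K) * critOrbit d c M ^ (d - 1)‖ ≤ ρ)
    (hret : ‖critOrbit d c (M + N) - critOrbit d c M‖ ≤ ρ)
    (hper : IsPreperiodic (unicriticalMap d c) 0) :
    ∃ n, critOrbit d c (n + N) = critOrbit d c n := by
  obtain ⟨m, l, hl, hper⟩ := hper.exists_iterate_add_eq
  have hρ₀ : 0 ≤ ρ := (norm_nonneg _).trans hret
  set M' := M + m * N
  have hmM' : m ≤ M' := (Nat.le_mul_of_pos_right m (Nat.pos_of_ne_zero hN)).trans le_add_self
  have hloop (i : ℕ) : critOrbit d c (M' + l * N + i) = critOrbit d c (M' + i) := by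
    rw [add_right_comm, mul_comm]
    exact iterate_add_mul_eq (hper _ (hmM'.trans le_self_add)) N
  have hret' : ‖critOrbit d c (M' + N) - critOrbit d c M'‖ ≤ ρ := by
    rw [add_right_comm]
    exact (norm_critOrbit_add_sub_le hc (M + N) M (m * N)).trans hret
  have hcontract := norm_critOrbit_add_mul_sub_le_pow_mul hc hN
    (norm_natCast_mul_critOrbit_add_mul_pow_le hc hder hret m) hret' l
  rw [hloop N, ← add_zero (M' + l * N), hloop 0, add_zero] at hcontract
  refine ⟨M', ?_⟩
  by_contra hne
  have hpos := norm_pos_iff.2 (sub_ne_zero.2 hne)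
  exact absurd (le_of_mul_le_mul_right ((one_mul _).trans_le hcontract) hpos)
    (pow_lt_one₀ hρ₀ hρ hl).not_ge

theorem norm_mul_norm_critOrbit_le (hc : ‖c‖ ≤ 1) (hd : d ≠ 0) {n : ℕ}
    (hne : critOrbit d c (n + N) ≠ critOrbit d c n)
    (heq : critOrbit d c (n + 1 + N) = critOrbit d c (n + 1)) :
    ‖(d : K)‖ * ‖critOrbit d c N‖ ≤ ‖critOrbit d c (n + N) - critOrbit d c n‖ := by
  have hpow : critOrbit d c (n + N) ^ d = critOrbit d c n ^ d := by
    rwa [add_right_comm, critOrbit_succ, critOrbit_succ, add_left_inj] at heq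
  have hnorm : ‖critOrbit d c (n + N)‖ = ‖critOrbit d c n‖ := by
    rw [← pow_left_inj₀ (norm_nonneg _) (norm_nonneg _) hd, ← norm_pow, hpow, norm_pow]
  have hN : ‖critOrbit d c N‖ ≤ ‖critOrbit d c n‖ := by
    have h := norm_critOrbit_add_sub_le (d := d) hc n 0 N
    rw [zero_add, critOrbit_zero, sub_zero, norm_sub_rev] at h
    exact norm_le_of_norm_sub_le h hnorm.le
  exact (mul_le_mul_of_nonneg_left hN (norm_nonneg _)).trans
    (norm_natCast_mul_norm_le_of_pow_eq hd hpow hne)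

theorem critOrbit_add_mul_add_eq_of_attracting (hc : ‖c‖ ≤ 1) (hd : d ≠ 0) (hN : N ≠ 0)
    (hρ : ρ < 1) {J : ℕ} (hJ : ρ ^ J < ‖(d : K)‖)
    (hder : ‖(d : K) * critOrbit d c M ^ (d - 1)‖ ≤ ρ)
    (hret : ‖critOrbit d c (M + N) - critOrbit d c M‖ ≤ ρ)
    (hper : IsPreperiodic (unicriticalMap d c) 0) :
    critOrbit d c (M + J * N + N) = critOrbit d c (M + J * N) := by
  classical
  have hex := exists_critOrbit_add_eq_of_attracting hc hN hρ hder hret hper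
  rcases le_or_gt (Nat.find hex) (M + J * N) with hle | hlt
  · exact iterate_add_eq_of_le (Nat.find_spec hex) hle
  -- If the period is entered only after `M + J * N`, then `z (n + N)` and `z n` are distinct points
  -- with the same image, which forces them further apart than the contraction allows.
  obtain ⟨n, hn⟩ := Nat.exists_eq_succ_of_ne_zero (Nat.ne_zero_of_lt hlt)
  have hne : critOrbit d c (n + N) ≠ critOrbit d c n := Nat.find_min hex (by omega)
  have heq : critOrbit d c (n + 1 + N) = critOrbit d c (n + 1) := by
    simpa only [hn] using Nat.find_spec hex
  have hmove : ‖critOrbit d c (n + N) - critOrbit d c n‖ ≤ ρ ^ J * ‖critOrbit d c N‖ := by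
    obtain ⟨i, rfl⟩ : ∃ i, n = M + J * N + i := Nat.exists_eq_add_of_le (by omega)
    have hρ₀ : 0 ≤ ρ := (norm_nonneg _).trans hret
    have hstart := norm_critOrbit_add_sub_le (d := d) hc N 0 M
    rw [critOrbit_zero, sub_zero, zero_add, add_comm N] at hstart
    calc _ ≤ ‖critOrbit d c (M + J * N + N) - critOrbit d c (M + J * N)‖ := by
          rw [add_right_comm]
          exact norm_critOrbit_add_sub_le hc _ _ i
      _ ≤ ρ ^ J * ‖critOrbit d c (M + N) - critOrbit d c M‖ :=
          norm_critOrbit_add_mul_sub_le_pow_mul hc hN hder hret J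
      _ ≤ ρ ^ J * ‖critOrbit d c N‖ := by gcongr
  have hN₀ : critOrbit d c N = 0 := by
    by_contra h
    exact absurd (le_of_mul_le_mul_right
      ((norm_mul_norm_critOrbit_le hc hd hne heq).trans hmove) (norm_pos_iff.2 h)) hJ.not_ge
  refine absurd (iterate_add_eq_of_le (m := 0) ?_ n.zero_le) hne
  rw [zero_add]
  exact hN₀

end Attracting

section Indifferent

variable {R : Type*} [CommRing R]

/-- The `n`-th iterate of `z ↦ z ^ d + c`, as a polynomial in the coordinate centered at `x`. -/
noncomputable def centeredIterate (d : ℕ) (c x : R) (n : ℕ) : R[X] :=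
  (unicriticalMap d (C c))^[n] (X + C x) - C x

theorem eval_centeredIterate (d : ℕ) (c x : R) (n : ℕ) (w : R) :
    (centeredIterate d c x n).eval w = (unicriticalMap d c)^[n] (w + x) - x := by
  have h := map_iterate_unicriticalMap (evalRingHom w) d (C c) (X + C x) n
  simp only [coe_evalRingHom, eval_C, eval_add, eval_X] at h
  rw [centeredIterate, eval_sub, eval_C, h]

theorem derivative_iterate_unicriticalMap (d : ℕ) (c : R) (P : R[X]) (n : ℕ) :
    derivative ((unicriticalMap d (C c))^[n] P) =
      (∏ i ∈ Finset.range n, d * (unicriticalMap d (C c))^[i] P ^ (d - 1)) * derivative P := by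
  induction n with
  | zero => simp
  | succ n ih =>
    rw [Function.iterate_succ_apply', Finset.prod_range_succ_comm, mul_assoc, ← ih, unicriticalMap,
      derivative_add, derivative_C, add_zero, derivative_pow, C_eq_natCast]

theorem coeff_one_centeredIterate (d : ℕ) (c : R) (m n : ℕ) :
    (centeredIterate d c (critOrbit d c m) n).coeff 1 = critMultiplier d c m n := by
  have hcoeff (P : R[X]) : P.coeff 1 = (derivative P).eval 0 := by
    rw [← coeff_zero_eq_eval_zero, coeff_derivative, zero_add, Nat.cast_zero,
      zero_add, mul_one]
  have heval (i : ℕ) : ((unicriticalMap d (C c))^[i] (X + C (critOrbit d c m))).eval 0 =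
      critOrbit d c (m + i) := by
    have h := map_iterate_unicriticalMap (evalRingHom 0) d (C c) (X + C (critOrbit d c m)) i
    simpa only [coe_evalRingHom, eval_C, eval_add, eval_X, zero_add, iterate_critOrbit] using h
  rw [hcoeff, centeredIterate, derivative_sub, derivative_iterate_unicriticalMap]
  simp [critMultiplier, eval_prod, heval]

variable {K : Type*} [NormedField K] [IsUltrametricDist K] {d : ℕ} {c x : K} {r : ℝ}

theorem norm_coeff_centeredIterate_le_one (hc : ‖c‖ ≤ 1) (hx : ‖x‖ ≤ 1) (n i : ℕ) :
    ‖(centeredIterate d c x n).coeff i‖ ≤ 1 := by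
  have hC {a : K} (ha : ‖a‖ ≤ 1) : diskNorm 1 (C a) ≤ 1 := (gaussNorm_C _ _ _).trans_le ha
  have hiterate : diskNorm 1 ((unicriticalMap d (C c))^[n] (X + C x)) ≤ 1 := by
    induction n with
    | zero => exact diskNorm_add_le zero_le_one (diskNorm_X 1).le (hC hx)
    | succ n ih =>
      rw [Function.iterate_succ_apply']
      refine diskNorm_add_le zero_le_one ?_ (hC hc)
      rw [diskNorm_pow one_pos]
      exact pow_le_one₀ (diskNorm_nonneg zero_le_one _) ih
  have hdisk : diskNorm 1 (centeredIterate d c x n) ≤ 1 := by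
    rw [centeredIterate, sub_eq_add_neg, ← C_neg]
    exact diskNorm_add_le zero_le_one hiterate (hC (by rwa [norm_neg]))
  simpa using (diskNorm_le_iff zero_le_one).1 hdisk i

theorem diskNorm_centeredIterate_sub_X_le (hr : 0 ≤ r) (hr1 : r ≤ 1) (hc : ‖c‖ ≤ 1) {m n : ℕ}
    (hret : ‖critOrbit d c (m + n) - critOrbit d c m‖ ≤ r * r)
    (hmul : ‖critMultiplier d c m n - 1‖ ≤ r) :
    diskNorm r (centeredIterate d c (critOrbit d c m) n - X) ≤ r * r := by
  refine (diskNorm_le_iff hr).2 fun i => ?_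
  rw [coeff_sub]
  rcases i with _ | _ | i
  · rwa [coeff_X_zero, sub_zero, pow_zero, mul_one, coeff_zero_eq_eval_zero,
      eval_centeredIterate, zero_add, iterate_critOrbit]
  · rw [zero_add, coeff_X_one, pow_one, coeff_one_centeredIterate]
    gcongr
  · rw [coeff_X_of_ne_one (by omega), sub_zero, ← sq]
    exact (mul_le_of_le_one_left (by positivity) (norm_coeff_centeredIterate_le_one hc
      (norm_critOrbit_le_one hc m) n _)).trans (pow_le_pow_of_le_one hr hr1 (by omega))

theorem critOrbit_add_mul_pow_eq_of_indifferent [CharZero K] {p J M N : ℕ} (hr : 0 < r)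
    (hr1 : r ≤ 1) (hp : ‖(p : K)‖ ≤ r) (hprime : ∀ q : ℕ, q.Prime → r ^ (J + 1) < ‖(q : K)‖)
    (hc : ‖c‖ ≤ 1) (hret : ‖critOrbit d c (M + N) - critOrbit d c M‖ ≤ r * r)
    (hmul : ‖critMultiplier d c M N - 1‖ ≤ r) (hper : IsPreperiodic (unicriticalMap d c) 0) :
    critOrbit d c (M + N * p ^ J) = critOrbit d c M := by
  set x := critOrbit d c M with hx
  set g : K → K := fun w => (centeredIterate d c x N).eval w
  have hnear : IsNearId (Metric.closedBall 0 r) (r ^ (J + 1)) g^[p ^ J] :=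
    isNearId_eval_iterate_pow hr hr1 hp
      (diskNorm_centeredIterate_sub_X_le hr.le hr1 hc hret hmul) J
  have hsemi : Function.Semiconj (fun z => z - x) (unicriticalMap d c)^[N * p ^ J] g^[p ^ J] := by
    have hN : Function.Semiconj (fun z => z - x) (unicriticalMap d c)^[N] g := fun z => by
      change _ = (centeredIterate d c x N).eval (z - x)
      rw [eval_centeredIterate, sub_add_cancel]
    rw [Function.iterate_mul]
    exact hN.iterate_right _
  have hgper : IsPreperiodic g^[p ^ J] (x - x) :=
    (hper.iterate (N * p ^ J) M).map (φ := fun z => z - x) hsemi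
  have hmem : x - x ∈ Metric.closedBall (0 : K) r := by simpa using hr.le
  have hfix := hnear.apply_eq_of_isPreperiodic (pow_nonneg hr.le _) hprime hmem hgper
  rwa [← hsemi x, sub_left_inj, hx, iterate_critOrbit] at hfix

end Indifferent

section Recurrence

theorem exists_lt_dist_lt_of_isBounded {X : Type*} [PseudoMetricSpace X] [ProperSpace X]
    {u : ℕ → X} (hu : Bornology.IsBounded (Set.range u)) {ε : ℝ} (hε : 0 < ε) :
    ∃ m n, m < n ∧ dist (u n) (u m) < ε := by
  obtain ⟨_, -, φ, hφ, hlim⟩ := tendsto_subseq_of_bounded hu Set.mem_range_self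
  obtain ⟨k, hk⟩ := Metric.cauchySeq_iff'.1 hlim.cauchySeq ε hε
  exact ⟨φ k, φ (k + 1), hφ k.lt_succ_self, hk (k + 1) k.le_succ⟩

variable {K : Type*} [NormedField K] [IsUltrametricDist K]

theorem exists_critOrbit_recurrent (𝕜 : Type*) [NontriviallyNormedField 𝕜] [ProperSpace 𝕜]
    [NormedAlgebra 𝕜 K] {b : K} (hint : IsIntegral 𝕜 b) (hb : ‖b‖ ≤ 1) (d : ℕ) {ε : ℝ}
    (hε : 0 < ε) :
    ∃ M N, N ≠ 0 ∧ ‖critOrbit d b (M + 1 + N) - critOrbit d b (M + 1)‖ < ε ∧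
      ‖critMultiplier d b 1 (M + N) - critMultiplier d b 1 M‖ < ε := by
  set E := Algebra.adjoin 𝕜 {b}
  have : FiniteDimensional 𝕜 E := Module.Finite.iff_fg.2 hint.fg_adjoin_singleton
  have : ProperSpace E := FiniteDimensional.proper 𝕜 E
  let β : E := ⟨b, Algebra.self_mem_adjoin_singleton 𝕜 b⟩
  have hz (n : ℕ) : ((critOrbit d β n : E) : K) = critOrbit d b n :=
    map_critOrbit E.val.toRingHom d β n
  have hlam (n : ℕ) : ((critMultiplier d β 1 n : E) : K) = critMultiplier d b 1 n :=
    map_critMultiplier E.val.toRingHom d β 1 n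
  have hbdd : Bornology.IsBounded
      (Set.range fun n => (critOrbit d β (n + 1), critMultiplier d β 1 n)) := by
    refine isBounded_iff_forall_norm_le.2 ⟨1, ?_⟩
    rintro _ ⟨n, rfl⟩
    refine max_le ?_ ?_
    · exact (congrArg norm (hz _)).trans_le (norm_critOrbit_le_one hb _)
    · exact (congrArg norm (hlam _)).trans_le (norm_critMultiplier_le_one hb _ _)
  obtain ⟨M, n, hMn, hdist⟩ := exists_lt_dist_lt_of_isBounded hbdd hε
  obtain ⟨N, rfl⟩ := Nat.exists_eq_add_of_le hMn.le
  obtain ⟨horbit, hmult⟩ := max_lt_iff.1 hdist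
  refine ⟨M, N, by omega, ?_, ?_⟩
  · rw [← hz, ← hz, ← dist_eq_norm, add_right_comm]
    exact horbit
  · rw [← hlam, ← hlam, ← dist_eq_norm]
    exact hmult

end Recurrence

section PadicNorm

variable {p : ℕ} [Fact p.Prime] {K : Type*} [NormedField K] [NormedAlgebra ℚ_[p] K]

theorem norm_natCast_eq_padicNorm (n : ℕ) : ‖(n : K)‖ = ‖(n : ℚ_[p])‖ := by
  rw [← map_natCast (algebraMap ℚ_[p] K), norm_algebraMap']

end PadicNorm

section UniformPeriod

variable {K : Type*} [NormedField K] [IsUltrametricDist K] {d : ℕ} {b c : K}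

theorem norm_critOrbit_sub_le_of_norm_sub_le {ρ : ℝ} (hc : ‖c‖ ≤ 1) (hb : ‖b‖ ≤ 1)
    (hcb : ‖c - b‖ ≤ ρ) {m n : ℕ} (h : ‖critOrbit d b m - critOrbit d b n‖ ≤ ρ) :
    ‖critOrbit d c m - critOrbit d c n‖ ≤ ρ := by
  refine norm_le_of_norm_sub_le ?_ h
  rw [sub_sub_sub_comm]
  exact norm_sub_le_of_norm_le ((norm_critOrbit_sub_critOrbit_le hc hb m).trans hcb)
    ((norm_critOrbit_sub_critOrbit_le hc hb n).trans hcb)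

theorem exists_forall_critOrbit_eq_of_attracting (hd : (d : K) ≠ 0) (hb : ‖b‖ ≤ 1) {s : ℝ}
    (hs : s < 1) {M N : ℕ} (hN : N ≠ 0) (hder : ‖(d : K) * critOrbit d b M ^ (d - 1)‖ < 1)
    (hret : ‖critOrbit d b (M + N) - critOrbit d b M‖ < 1) :
    ∃ T, ∀ c, ‖c - b‖ ≤ s → IsPreperiodic (unicriticalMap d c) 0 →
      critOrbit d c (T + N) = critOrbit d c T := by
  set ρ := max s (max ‖(d : K) * critOrbit d b M ^ (d - 1)‖
    ‖critOrbit d b (M + N) - critOrbit d b M‖)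
  have hρ : ρ < 1 := max_lt hs (max_lt hder hret)
  obtain ⟨J, hJ⟩ := exists_pow_lt_of_lt_one (norm_pos_iff.2 hd) hρ
  refine ⟨M + J * N, fun c hcb hper => ?_⟩
  have hc : ‖c‖ ≤ 1 := norm_le_of_norm_sub_le (hcb.trans hs.le) hb
  have hcbρ : ‖c - b‖ ≤ ρ := hcb.trans (le_max_left _ _)
  refine critOrbit_add_mul_add_eq_of_attracting hc (by rintro rfl; simp at hd) hN hρ hJ ?_
    (norm_critOrbit_sub_le_of_norm_sub_le hc hb hcbρ
      ((le_max_right _ _).trans (le_max_right _ _))) hper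
  refine norm_le_of_norm_sub_le ?_ ((le_max_left _ _).trans (le_max_right _ _))
  exact (norm_natCast_mul_pow_sub_le (norm_critOrbit_le_one hc M) (norm_critOrbit_le_one hb M)
    d (d - 1)).trans ((norm_critOrbit_sub_critOrbit_le hc hb M).trans hcbρ)

variable {p : ℕ} [Fact p.Prime] [NormedAlgebra ℚ_[p] K]

theorem exists_indifferent_return (hint : IsIntegral ℚ_[p] b) (hb : ‖b‖ ≤ 1)
    (hneutral : ∀ k, ‖(d : K) * critOrbit d b (k + 1) ^ (d - 1)‖ = 1) {ε : ℝ} (hε : 0 < ε) :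
    ∃ M N, N ≠ 0 ∧ ‖critOrbit d b (M + N) - critOrbit d b M‖ < ε ∧
      ‖critMultiplier d b M N - 1‖ < ε := by
  obtain ⟨M, N, hN, hret, hmul⟩ := exists_critOrbit_recurrent ℚ_[p] hint hb d hε
  refine ⟨M + 1, N, hN, hret, ?_⟩
  have hunit : ‖critMultiplier d b 1 M‖ = 1 := by
    rw [critMultiplier, norm_prod]
    exact Finset.prod_eq_one fun i _ => by rw [add_comm 1, hneutral]
  rwa [critMultiplier_add, ← mul_sub_one, norm_mul, hunit, one_mul, add_comm 1] at hmul

theorem exists_forall_critOrbit_eq_of_indifferent [CharZero K] {s : ℝ} (hs : s < 1)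
    (hint : IsIntegral ℚ_[p] b) (hb : ‖b‖ ≤ 1)
    (hneutral : ∀ k, ‖(d : K) * critOrbit d b (k + 1) ^ (d - 1)‖ = 1) :
    ∃ T N, N ≠ 0 ∧ ∀ c, ‖c - b‖ ≤ s → IsPreperiodic (unicriticalMap d c) 0 →
      critOrbit d c (T + N) = critOrbit d c T := by
  set r := max √s ‖(p : K)‖
  have hp₀ : 0 < ‖(p : K)‖ := norm_pos_iff.2 (Nat.cast_ne_zero.2 (NeZero.ne p))
  have hr : 0 < r := hp₀.trans_le (le_max_right _ _)
  have hr1 : r < 1 := by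
    refine max_lt ((Real.sqrt_lt' one_pos).2 (by rwa [one_pow])) ?_
    rw [norm_natCast_eq_padicNorm (p := p)]
    exact Padic.norm_p_lt_one
  have hsr : s ≤ r * r := by
    rw [← sq, ← Real.sqrt_le_left hr.le]
    exact le_max_left _ _
  obtain ⟨M, N, hN, hret, hmul⟩ := exists_indifferent_return hint hb hneutral (mul_pos hr hr)
  obtain ⟨J, hJ⟩ := exists_pow_lt_of_lt_one hp₀ hr1
  have hJ' : r ^ (J + 1) < ‖(p : K)‖ := (pow_le_pow_of_le_one hr.le hr1.le J.le_succ).trans_lt hJ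
  have hprime (q : ℕ) (hq : q.Prime) : r ^ (J + 1) < ‖(q : K)‖ := by
    rcases eq_or_ne q p with rfl | hqp
    · exact hJ'
    · rw [norm_natCast_eq_padicNorm (p := p), (Padic.norm_natCast_eq_one_iff).2
        ((Nat.coprime_primes Fact.out hq).2 hqp.symm)]
      exact pow_lt_one₀ hr.le hr1 J.succ_ne_zero
  refine ⟨M, N * p ^ J, mul_ne_zero hN (pow_ne_zero _ (NeZero.ne p)), fun c hcb hper => ?_⟩
  have hc : ‖c‖ ≤ 1 := norm_le_of_norm_sub_le (hcb.trans hs.le) hb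
  have hcbr : ‖c - b‖ ≤ r * r := hcb.trans hsr
  have hrr : r * r ≤ r := mul_le_of_le_one_left hr.le hr1.le
  exact critOrbit_add_mul_pow_eq_of_indifferent hr hr1.le (le_max_right _ _) hprime hc
    (norm_critOrbit_sub_le_of_norm_sub_le hc hb hcbr hret.le)
    (norm_sub_le_trans
      ((norm_critMultiplier_sub_critMultiplier_le hc hb M N).trans (hcbr.trans hrr))
      (hmul.le.trans hrr)) hper

theorem exists_forall_critOrbit_eq [CharZero K] (hd : 2 ≤ d) {s : ℝ} (hs : s < 1)
    (hint : IsIntegral ℚ_[p] b) (hb : ‖b‖ ≤ 1) :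
    ∃ T N, N ≠ 0 ∧ ∀ c, ‖c - b‖ ≤ s → IsPreperiodic (unicriticalMap d c) 0 →
      critOrbit d c (T + N) = critOrbit d c T := by
  have hd₀ : (d : K) ≠ 0 := Nat.cast_ne_zero.2 (by omega)
  by_cases hneutral : ∀ k, ‖(d : K) * critOrbit d b (k + 1) ^ (d - 1)‖ = 1
  · exact exists_forall_critOrbit_eq_of_indifferent hs hint hb hneutral
  push Not at hneutral
  obtain ⟨k, hk⟩ := hneutral
  rcases (IsUltrametricDist.norm_natCast_le_one K d).lt_or_eq with hlt | heq
  · obtain ⟨M, N, hN, hret, -⟩ := exists_critOrbit_recurrent ℚ_[p] hint hb d one_pos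
    have hder : ‖(d : K) * critOrbit d b (M + 1) ^ (d - 1)‖ < 1 := by
      rw [norm_mul, norm_pow]
      exact mul_lt_one_of_nonneg_of_lt_one_left (norm_nonneg _) hlt
        (pow_le_one₀ (norm_nonneg _) (norm_critOrbit_le_one hb _))
    obtain ⟨T, hT⟩ := exists_forall_critOrbit_eq_of_attracting hd₀ hb hs hN hder hret
    exact ⟨T, N, hN, hT⟩
  · have hret : ‖critOrbit d b (k + 1)‖ < 1 := by
      refine (norm_critOrbit_le_one hb _).lt_of_ne fun h => hk ?_
      rw [norm_mul, norm_pow, heq, h, one_pow, one_mul]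
    obtain ⟨T, hT⟩ := exists_forall_critOrbit_eq_of_attracting (M := 0) hd₀ hb hs k.succ_ne_zero
      (by simp [critOrbit_zero, zero_pow (by omega : d - 1 ≠ 0)])
      (by rwa [zero_add, critOrbit_zero, sub_zero])
    exact ⟨T, k + 1, k.succ_ne_zero, hT⟩

theorem finite_setOf_isPCF_of_isIntegral [CharZero K] [IsAlgClosed K] (hd : 2 ≤ d) {s : ℝ}
    (hs : s < 1) (hint : IsIntegral ℚ_[p] b) (hb : ‖b‖ ≤ 1) :
    {c : K | c ∈ Metric.closedBall b s ∧ IsPCF (unicritical d c)}.Finite := by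
  obtain ⟨T, N, hN, hT⟩ := exists_forall_critOrbit_eq hd hs hint hb
  refine (finite_setOf_critOrbit_eq hd (by omega : T < T + N)).subset fun c hc => ?_
  exact hT c (mem_closedBall_iff_norm.1 hc.1) (hc.2.isPreperiodic_zero hd)

theorem finite_setOf_isPCF [CharZero K] [IsAlgClosed K] (hK : Dense {b : K | IsIntegral ℚ_[p] b})
    (hd : 2 ≤ d) (a : K) {s : ℝ} (hs : s < 1) :
    {c : K | c ∈ Metric.closedBall a s ∧ IsPCF (unicritical d c)}.Finite := by
  rcases Set.eq_empty_or_nonempty {c : K | c ∈ Metric.closedBall a s ∧ IsPCF (unicritical d c)}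
    with hempty | ⟨c₀, hc₀, hpcf⟩
  · exact hempty ▸ Set.finite_empty
  obtain ⟨b, hba, hint⟩ := Metric.dense_iff.1 hK a 1 one_pos
  rw [mem_ball_iff_norm] at hba
  have hb : ‖b‖ ≤ 1 := by
    have hac₀ : ‖a - c₀‖ ≤ 1 := (mem_closedBall_iff_norm'.1 hc₀).trans hs.le
    exact norm_le_of_norm_sub_le (norm_sub_le_trans hba.le hac₀)
      (norm_le_one_of_isPreperiodic hd (hpcf.isPreperiodic_zero hd))
  refine (finite_setOf_isPCF_of_isIntegral hd (max_lt hs hba) hint hb).subset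
    fun c hc => ⟨?_, hc.2⟩
  rw [mem_closedBall_iff_norm]
  exact norm_sub_le_trans ((mem_closedBall_iff_norm.1 hc.1).trans (le_max_left _ _))
    ((norm_sub_rev a b).trans_le (le_max_right _ _))

end UniformPeriod

theorem dense_setOf_isIntegral_padicComplex (p : ℕ) [Fact p.Prime] :
    Dense {b : PadicComplex p | IsIntegral ℚ_[p] b} := by
  refine Dense.mono ?_ (UniformSpace.Completion.denseRange_coe (α := PadicAlgCl p))
  rintro _ ⟨x, rfl⟩
  exact (Algebra.IsIntegral.isIntegral (R := ℚ_[p]) x).algebraMap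

end RatDyn

open RatDyn in
theorem theorem1p4_general {p : ℕ} [Fact p.Prime] {K : Type*} [NormedField K]
    [NormedAlgebra ℚ_[p] K] [IsAlgClosed K] (hK : Dense {b : K | IsIntegral ℚ_[p] b}) {d : ℕ}
    (hd : 2 ≤ d) :
    (∀ c : K, IsPCF (unicritical d c) → ‖c‖ ≤ 1) ∧
      ∀ (a : K) (s : ℝ), s < 1 →
        {c : K | c ∈ Metric.closedBall a s ∧ IsPCF (unicritical d c)}.Finite := by
  have : IsUltrametricDist K := IsUltrametricDist.of_normedAlgebra ℚ_[p]
  have : CharZero K := charZero_of_injective_algebraMap (algebraMap ℚ_[p] K).injective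
  exact ⟨fun c hc => norm_le_one_of_isPreperiodic hd (hc.isPreperiodic_zero hd),
    fun a s hs => finite_setOf_isPCF hK hd a hs⟩

theorem theorem1p4 (p : ℕ) [Fact p.Prime] (d : ℕ) (hd : 2 ≤ d) :
    (∀ c : PadicComplex p, RatDyn.IsPCF (RatDyn.unicritical d c) → ‖c‖ ≤ 1) ∧
    (∀ a : PadicComplex p, ‖a‖ ≤ 1 → ∀ s : ℝ, 0 < s → s < 1 →
      {c : PadicComplex p | c ∈ Metric.closedBall a s ∧
        RatDyn.IsPCF (RatDyn.unicritical d c)}.Finite) := by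
  obtain ⟨hnorm, hfinite⟩ := theorem1p4_general (RatDyn.dense_setOf_isIntegral_padicComplex p) hd
  exact ⟨hnorm, fun a _ s _ hs => hfinite a s hs⟩
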